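/- Let $\Omega\subset\mathbb R^d$ ($d=2,3$) be a bounded domain with Lipschitz boundary, let $\Gamma_D,\Gamma_N\subset\partial\Omega$ be disjoint and measurable, $\mathbf s\in L^2(\Gamma_N)^d$, $\mathbf f^0\in L^2(\Omega)^d$, let $\mathbf E^0$ be a constant, symmetric, positive definite stiffness tensor (for instance that of an isotropic material), $E_{\min},f_{\min},\beta\in(0,1)$, $\gamma,\epsilon>0$, $p\ge 1$ (for instance $p=3$), $V_0=\beta|\Omega|$, and $$\mathbf E(\phi)=(E_{\min}+(1-E_{\min})\phi^p)\mathbf E^0,\quad \mathbf f(\phi)=(f_{\min}+(1-f_{\min})\phi^p)\mathbf f^0,\quad F(\phi)=\tfrac14\phi^2(1-\phi)^2 .$$ Put $\varepsilon(\mathbf u)=\frac12(\nabla\mathbf u+(\nabla\mathbf u)^T)$, $\mathcal V=\{\mathbf v\in H^1(\Omega)^d:\mathbf v|_{\Gamma_D}=\mathbf 0\}$ and $$J(\phi,\mathbf u)=\int_{\Gamma_N}\mathbf s\cdot\mathbf u\,ds+\int_\Omega\mathbf f(\phi)\cdot\mathbf u\,d\mathbf x+\gamma\int_\Omega\Big(\frac{\epsilon}{2}|\nabla\phi|^2+\frac1\epsilon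 F(\phi)\Big)d\mathbf x .$$ Let $\phi(t)\in H^1(\Omega)$, $\mathbf u(t)=\mathbf u(\phi(t))\in\mathcal V$, $\lambda(t)\in\mathbb R$, $\eta(t)\in L^2(\Omega)$, $t>0$, be such that $t\mapsto\phi(t)$ is differentiable with values in $H^1(\Omega)\cap L^\infty(\Omega)$, with derivative $\phi_t$, and $t\mapsto\mathbf u(t)$ is continuous with values in $L^2(\Omega)^d$. Suppose that $(\phi,\mathbf u)$ solves the following coupled system for $t>0$: the state equation, in the weak sense (test functions in $\mathcal V$), $$-\nabla\cdot(\mathbf E(\phi)\varepsilon(\mathbf u))=\mathbf f(\phi)\ \text{in }\Omega,\quad \mathbf u=\mathbf 0\ \text{on }\Gamma_D,\quad \mathbf E(\phi)\varepsilon(\mathbf u)\mathbf n=\mathbf s\ \text{on }\Gamma_N,\quad \mathbf E(\phi)\varepsilon(\mathbf u)\mathbf n=\mathbf 0\ \text{on }\partial\Omega\setminus(\Gamma_D\cup\Gamma_N),$$ and the gradient flow, in the weak sense (test functions in $H^1(\Omega)\cap L^\infty(\Omega)$), $$\phi_t=\gamma\epsilon\Delta\phi-\frac{\gamma}{\epsilon}F'(\phi)+\mathbf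 E'(\phi)\varepsilon(\mathbf u):\varepsilon(\mathbf u)-2\mathbf f'(\phi)\cdot\mathbf u-\lambda-\eta(1-2\phi)\ \text{in }\Omega,\qquad \frac{\partial\phi}{\partial\mathbf n}=0\ \text{on }\partial\Omega,$$ with $\phi(t)\to\phi^0$ in $L^2(\Omega)$ as $t\to0^+$, together with the Karush–Kuhn–Tucker conditions $$\lambda\ge0,\quad \int_\Omega\phi\,d\mathbf x-V_0=0,\quad \lambda\Big(\int_\Omega\phi\,d\mathbf x-V_0\Big)=0,\qquad \eta\ge0,\quad \phi(1-\phi)\ge0,\quad \eta\,\phi(1-\phi)=0\ \text{ a.e. in }\Omega .$$ Then for every $t>0$ the function $t\mapsto J(\phi(t),\mathbf u(t))$ is differentiable and $$\frac{d}{dt}J(\phi,\mathbf u(\phi))=-\|\phi_t\|_{L^2(\Omega)}^2\le 0 .$$ -/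

import Mathlib

open MeasureTheory Filter Topology Set
open scoped ContDiff

namespace PhaseFieldTopOpt

/-- Points of `ℝ^d`, with the Euclidean norm. -/
abbrev Pt (d : ℕ) : Type := EuclideanSpace ℝ (Fin d)

/-- The surface measure: the `(d-1)`-dimensional Hausdorff measure, normalised so that it is the
usual area of hypersurfaces. -/
noncomputable def surf (d : ℕ) : Measure (Pt d) := Measure.euclideanHausdorffMeasure (d - 1)

/-- `Ω` has a Lipschitz boundary: near every boundary point, `Ω` is the strict epigraph, in some
direction `n`, of a Lipschitz function on the hyperplane orthogonal to `n`. -/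
def HasLipschitzBoundary {d : ℕ} (Ω : Set (Pt d)) : Prop :=
  ∀ x₀ ∈ frontier Ω, ∃ (n : Pt d) (K : NNReal) (h : Pt d → ℝ), ‖n‖ = 1 ∧ LipschitzWith K h ∧
    ∀ᶠ x in 𝓝 x₀, (x ∈ Ω ↔ h (x - (inner ℝ x n) • n) < inner ℝ x n)

/-- `G` is the weak gradient of `v` in `Ω` (tested with smooth functions compactly supported
in `Ω`). -/
def IsWeakGradient {d : ℕ} (Ω : Set (Pt d)) (v : Pt d → ℝ) (G : Pt d → Pt d) : Prop :=
  ∀ θ : Pt d → ℝ, ContDiff ℝ ∞ θ → HasCompactSupport θ → tsupport θ ⊆ Ω →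
    ∀ i : Fin d, ∫ x in Ω, v x * gradient θ x i = - ∫ x in Ω, G x i * θ x

/-- A function in the Sobolev space `H¹(Ω)`, given by a representative together with a
representative of its weak gradient (which is unique up to null sets). -/
structure H1 {d : ℕ} (Ω : Set (Pt d)) where
  val : Pt d → ℝ
  grad : Pt d → Pt d
  memLp_val : MemLp val 2 (volume.restrict Ω)
  memLp_grad : MemLp grad 2 (volume.restrict Ω)
  weak : IsWeakGradient Ω val grad

/-- `g` is the boundary trace of `v ∈ H¹(Ω)`: for some functions, smooth up to the boundary and
converging to `v` in `H¹(Ω)`, the boundary values converge to `g` in `L²(∂Ω)`. On a bounded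
Lipschitz domain every `v` has exactly one trace up to null sets. -/
def IsTrace {d : ℕ} {Ω : Set (Pt d)} (v : H1 Ω) (g : Pt d → ℝ) : Prop :=
  MemLp g 2 ((surf d).restrict (frontier Ω)) ∧
  ∃ w : ℕ → Pt d → ℝ, (∀ k, ContDiff ℝ ∞ (w k)) ∧
    Tendsto (fun k => eLpNorm (fun x => w k x - v.val x) 2 (volume.restrict Ω)) atTop (𝓝 0) ∧
    Tendsto (fun k => eLpNorm (fun x => gradient (w k) x - v.grad x) 2 (volume.restrict Ω))
      atTop (𝓝 0) ∧
    Tendsto (fun k => eLpNorm (fun x => w k x - g x) 2 ((surf d).restrict (frontier Ω)))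
      atTop (𝓝 0)

/-- Double contraction `A : B = ∑ᵢⱼ Aᵢⱼ Bᵢⱼ`. -/
def ddot {d : ℕ} (A B : Matrix (Fin d) (Fin d) ℝ) : ℝ := ∑ i, ∑ j, A i j * B i j

/-- A symmetric, positive definite stiffness tensor, acting on `d × d` matrices. -/
structure IsStiffnessTensor {d : ℕ}
    (C : Matrix (Fin d) (Fin d) ℝ →ₗ[ℝ] Matrix (Fin d) (Fin d) ℝ) : Prop where
  isSymm : ∀ A, A.IsSymm → (C A).IsSymm
  major : ∀ A B, A.IsSymm → B.IsSymm → ddot (C A) B = ddot A (C B)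
  pos : ∀ A, A.IsSymm → A ≠ 0 → 0 < ddot (C A) A

/-- The data of the optimisation problem, with the standing assumptions on them. -/
structure Data (d : ℕ) where
  /-- design domain -/
  Ω : Set (Pt d)
  isOpen : IsOpen Ω
  bounded : Bornology.IsBounded Ω
  lipschitz : HasLipschitzBoundary Ω
  /-- Dirichlet part of the boundary -/
  ΓD : Set (Pt d)
  /-- loaded (Neumann) part of the boundary -/
  ΓN : Set (Pt d)
  measurable_ΓD : MeasurableSet ΓD
  measurable_ΓN : MeasurableSet ΓN
  ΓD_subset : ΓD ⊆ frontier Ω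
  ΓN_subset : ΓN ⊆ frontier Ω
  disjoint : Disjoint ΓD ΓN
  /-- surface traction -/
  s : Pt d → Pt d
  memLp_s : MemLp s 2 ((surf d).restrict ΓN)
  /-- body force of the solid material -/
  f0 : Pt d → Pt d
  memLp_f0 : MemLp f0 2 (volume.restrict Ω)
  /-- stiffness tensor of the solid material -/
  E0 : Matrix (Fin d) (Fin d) ℝ →ₗ[ℝ] Matrix (Fin d) (Fin d) ℝ
  stiffness : IsStiffnessTensor E0
  Emin : ℝ
  Emin_mem : Emin ∈ Ioo (0 : ℝ) 1
  fmin : ℝ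
  fmin_mem : fmin ∈ Ioo (0 : ℝ) 1
  /-- penalty exponent -/
  p : ℝ
  one_le_p : 1 ≤ p
  /-- weight of the interface energy -/
  γ : ℝ
  γ_pos : 0 < γ
  /-- interface thickness -/
  ε : ℝ
  ε_pos : 0 < ε
  /-- prescribed volume fraction -/
  β : ℝ
  β_mem : β ∈ Ioo (0 : ℝ) 1

/-- The interpolation `r ↦ m + (1 - m) r ^ p` between void and solid. -/
noncomputable def interp (m p r : ℝ) : ℝ := m + (1 - m) * r ^ p

/-- The double-well potential. -/
noncomputable def well (r : ℝ) : ℝ := 1 / 4 * r ^ 2 * (1 - r) ^ 2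

variable {d : ℕ}

/-- The scalar factor of `E(φ) = Efac(φ) E⁰`. -/
noncomputable def Data.Efac (P : Data d) (r : ℝ) : ℝ := interp P.Emin P.p r

/-- The scalar factor of `f(φ) = ffac(φ) f⁰`. -/
noncomputable def Data.ffac (P : Data d) (r : ℝ) : ℝ := interp P.fmin P.p r

/-- The prescribed volume `V₀ = β |Ω|`. -/
noncomputable def Data.V0 (P : Data d) : ℝ := P.β * (volume P.Ω).toReal

/-- An admissible displacement: an element of `H¹(Ω)^d` whose trace vanishes on `ΓD`, given with
its trace on `∂Ω`. -/
structure Displacement (P : Data d) where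
  comp : Fin d → H1 P.Ω
  tr : Fin d → Pt d → ℝ
  isTrace : ∀ i, IsTrace (comp i) (tr i)
  dirichlet : ∀ i, ∀ᵐ x ∂((surf d).restrict P.ΓD), tr i x = 0

/-- The strain `ε(u) = (∇u + ∇uᵀ) / 2`. -/
noncomputable def Displacement.strain {P : Data d} (u : Displacement P) (x : Pt d) :
    Matrix (Fin d) (Fin d) ℝ :=
  Matrix.of fun i j => ((u.comp i).grad x j + (u.comp j).grad x i) / 2

/-- The pointwise product `f⁰ · u`. -/
noncomputable def Displacement.f0dot {P : Data d} (u : Displacement P) (x : Pt d) : ℝ :=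
  ∑ i, P.f0 x i * (u.comp i).val x

/-- The work of the external forces, `∫_{ΓN} s · v + ∫_Ω f(φ) · v`. -/
noncomputable def load (P : Data d) (φ : H1 P.Ω) (v : Displacement P) : ℝ :=
  (∫ x in P.ΓN, ∑ i, P.s x i * v.tr i x ∂(surf d)) +
    ∫ x in P.Ω, P.ffac (φ.val x) * v.f0dot x

/-- The objective functional `J(φ, u)`: compliance plus `γ` times the Ginzburg-Landau energy. -/
noncomputable def J (P : Data d) (φ : H1 P.Ω) (u : Displacement P) : ℝ :=
  load P φ u +
    P.γ * ∫ x in P.Ω, (P.ε / 2 * ‖φ.grad x‖ ^ 2 + 1 / P.ε * well (φ.val x))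

/-- `u` solves the elasticity state equation for the phase field `φ`: weak form of
`-∇·(E(φ) ε(u)) = f(φ)` in `Ω`, `u = 0` on `ΓD`, `E(φ) ε(u) n = s` on `ΓN` and
`E(φ) ε(u) n = 0` on the rest of the boundary. -/
def IsState (P : Data d) (φ : H1 P.Ω) (u : Displacement P) : Prop :=
  ∀ v : Displacement P,
    ∫ x in P.Ω, P.Efac (φ.val x) * ddot (P.E0 (u.strain x)) (v.strain x) = load P φ v

/-- `φ'` is the time derivative at `t` of the curve `φ` in `H¹(Ω) ∩ L^∞(Ω)`: the difference
quotients converge to it in that space. -/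
def HasTimeDeriv {Ω : Set (Pt d)} (φ : ℝ → H1 Ω) (φ' : H1 Ω) (t : ℝ) : Prop :=
  Tendsto (fun h : ℝ => eLpNorm (fun x => h⁻¹ * ((φ (t + h)).val x - (φ t).val x) - φ'.val x) 2
    (volume.restrict Ω)) (𝓝[≠] 0) (𝓝 0) ∧
  Tendsto (fun h : ℝ => eLpNorm (fun x => h⁻¹ • ((φ (t + h)).grad x - (φ t).grad x) - φ'.grad x) 2
    (volume.restrict Ω)) (𝓝[≠] 0) (𝓝 0) ∧
  Tendsto (fun h : ℝ => eLpNorm (fun x => h⁻¹ * ((φ (t + h)).val x - (φ t).val x) - φ'.val x) ⊤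
    (volume.restrict Ω)) (𝓝[≠] 0) (𝓝 0)

/-- Solutions `(φ, u)`, with multipliers `lam` and `η`, of the coupled system: the elasticity state
equation, and the constrained Allen-Cahn gradient flow with its Karush-Kuhn-Tucker conditions.
`φt` is the time derivative of `φ`. Only the values at times `t > 0` matter. -/
structure IsSolution (P : Data d) (φ₀ : Pt d → ℝ) (φ φt : ℝ → H1 P.Ω)
    (u : ℝ → Displacement P) (lam : ℝ → ℝ) (η : ℝ → Pt d → ℝ) : Prop where
  /-- `φ` is differentiable in time with values in `H¹(Ω) ∩ L^∞(Ω)` -/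
  timeDeriv : ∀ t > 0, HasTimeDeriv φ (φt t) t
  /-- `u` is continuous in time with values in `L²(Ω)^d` -/
  continuous_u : ∀ t > 0, ∀ i, Tendsto
    (fun τ => eLpNorm (fun x => ((u τ).comp i).val x - ((u t).comp i).val x) 2
      (volume.restrict P.Ω)) (𝓝 t) (𝓝 0)
  memLp_η : ∀ t > 0, MemLp (η t) 2 (volume.restrict P.Ω)
  /-- initial condition `φ(0) = φ₀` -/
  initial : MemLp φ₀ 2 (volume.restrict P.Ω) ∧
    Tendsto (fun t => eLpNorm (fun x => (φ t).val x - φ₀ x) 2 (volume.restrict P.Ω))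
      (𝓝[>] 0) (𝓝 0)
  /-- elasticity state equation -/
  state : ∀ t > 0, IsState P (φ t) (u t)
  /-- weak form of `φ_t = γ ε Δφ - (γ/ε) F'(φ) + E'(φ) ε(u):ε(u) - 2 f'(φ)·u - lam - η (1 - 2φ)`
  in `Ω` with `∂φ/∂n = 0` on `∂Ω`, tested with functions in `H¹(Ω) ∩ L^∞(Ω)` -/
  flow : ∀ t > 0, ∀ ψ : H1 P.Ω, MemLp ψ.val ⊤ (volume.restrict P.Ω) →
    ∫ x in P.Ω, (φt t).val x * ψ.val x =
      -(P.γ * P.ε * ∫ x in P.Ω, inner ℝ ((φ t).grad x) (ψ.grad x)) +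
      ∫ x in P.Ω,
        (-(P.γ / P.ε) * deriv well ((φ t).val x)
          + deriv P.Efac ((φ t).val x) * ddot (P.E0 ((u t).strain x)) ((u t).strain x)
          - 2 * (deriv P.ffac ((φ t).val x) * (u t).f0dot x)
          - lam t - η t x * (1 - 2 * (φ t).val x)) * ψ.val x
  /-- volume constraint, multiplier and complementarity -/
  volume_constraint : ∀ t > 0, 0 ≤ lam t ∧ (∫ x in P.Ω, (φ t).val x) - P.V0 = 0 ∧
    lam t * ((∫ x in P.Ω, (φ t).val x) - P.V0) = 0
  /-- bound constraint, multiplier and complementarity -/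
  bound_constraint : ∀ t > 0, ∀ᵐ x ∂(volume.restrict P.Ω), 0 ≤ η t x ∧
    0 ≤ (φ t).val x * (1 - (φ t).val x) ∧ η t x * ((φ t).val x * (1 - (φ t).val x)) = 0

end PhaseFieldTopOpt

/-! The time derivative of `J` is computed directly, without differentiating `u` in time and without
an adjoint problem. Compliance is self-adjoint: testing each of two state equations with the other
state and using the major symmetry of `E0` gives the exact increment formula `compliance_sub`,
`load(φ₁,u₁) - load(φ,u) = ∫ (f(φ₁)-f(φ))·(u₁+u) - ∫ (E(φ₁)-E(φ)) ε(u₁):ε(u)`. Every term carries an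
increment of a coefficient, so after division by the time step only continuity of the state is
needed. The coefficient quotients converge in `L^∞`, since `φ` is differentiable there and the
interpolations are `C¹`; the remaining factors converge in `L¹`. For `f⁰·u₁` this is Hölder and the
assumed `L²` continuity of `u`. For `ε(u₁):ε(u)` it comes from the stability estimate
`integral_energyGap_le`: the strain energy of `u₁ - u` is bounded through the coefficient increments
and the already controlled `f⁰·(u₁ - u)`, so no Korn inequality enters. Hence the compliance has
derivative `2∫ f'(φ)φ_t·u - ∫ E'(φ)φ_t ε(u):ε(u)`, and the Ginzburg-Landau part is differentiated in
the usual way.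

It remains to test the flow with `φ_t`, which is bounded and hence admissible. Neither multiplier
contributes: `∫ φ_t = 0` because the volume is constant, and `η φ_t = 0` because `η` lives where `φ`
is 0 or 1, where a two-sided time derivative of a curve confined to `[0,1]` must vanish. What is
left says that the derivative of `J` is `-∫ φ_t²`. -/

namespace PhaseFieldTopOpt

/-! ### Pairing essentially uniform convergence with `L¹` convergence -/

section UniformAE

variable {α ι : Type*} [MeasurableSpace α] {μ : Measure α} {l : Filter ι}

/-- Uniform convergence outside null sets, along a filter. -/
def TendstoUniformlyAE (μ : Measure α) (D : ι → α → ℝ) (D₀ : α → ℝ) (l : Filter ι) : Prop :=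
  ∀ ε > 0, ∀ᶠ i in l, ∀ᵐ x ∂μ, |D i x - D₀ x| ≤ ε

theorem tendstoUniformlyAE_of_eLpNorm_top {D : ι → α → ℝ} {D₀ : α → ℝ}
    (h : Tendsto (fun i => eLpNorm (fun x => D i x - D₀ x) ⊤ μ) l (𝓝 0)) :
    TendstoUniformlyAE μ D D₀ l := by
  intro ε hε
  have hε' : (0 : ENNReal) < ENNReal.ofReal ε := ENNReal.ofReal_pos.2 hε
  filter_upwards [h.eventually_lt_const hε'] with i hi
  rw [eLpNorm_exponent_top] at hi
  filter_upwards [ae_le_eLpNormEssSup (f := fun x => D i x - D₀ x) (μ := μ)] with x hx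
  have h1 := hx.trans hi.le
  rw [Real.enorm_eq_ofReal_abs] at h1
  exact (ENNReal.ofReal_le_ofReal_iff hε.le).1 h1

/-- Pairing of a uniformly convergent family with an `L¹`-convergent one. -/
theorem TendstoUniformlyAE.tendsto_integral_mul {D : ι → α → ℝ} {D₀ : α → ℝ}
    {G : ι → α → ℝ} {G₀ : α → ℝ} {M : ℝ} (hD : TendstoUniformlyAE μ D D₀ l)
    (hDm : ∀ i, AEStronglyMeasurable (D i) μ) (hD₀m : AEStronglyMeasurable D₀ μ)
    (hM : ∀ᵐ x ∂μ, |D₀ x| ≤ M) (hG : ∀ i, Integrable (G i) μ) (hG₀ : Integrable G₀ μ)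
    (hGlim : Tendsto (fun i => ∫ x, |G i x - G₀ x| ∂μ) l (𝓝 0)) :
    Tendsto (fun i => ∫ x, D i x * G i x ∂μ) l (𝓝 (∫ x, D₀ x * G₀ x ∂μ)) := by
  have hM' : ∀ᵐ x ∂μ, |D₀ x| ≤ |M| := hM.mono fun x hx => hx.trans (le_abs_self M)
  rw [Metric.tendsto_nhds]
  intro ε hε
  set A := ∫ x, |G₀ x| ∂μ with hA
  have hA0 : 0 ≤ A := integral_nonneg fun x => abs_nonneg _
  -- `δ ≤ 1` keeps `|D i|` below `|M| + 1`; `δ * A < ε / 2` pays for replacing `D i` by `D₀` against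
  -- `G₀`.
  obtain ⟨δ, hδ, hδ1, hδA⟩ : ∃ δ > 0, δ ≤ 1 ∧ δ * A < ε / 2 := by
    refine ⟨min 1 (ε / (2 * (A + 1))), by positivity, min_le_left _ _, ?_⟩
    calc _ ≤ ε / (2 * (A + 1)) * A := by gcongr; exact min_le_right _ _
      _ < ε / (2 * (A + 1)) * (A + 1) := by gcongr; linarith
      _ = ε / 2 := by field_simp
  have hlim : Tendsto (fun i => (|M| + 1) * ∫ x, |G i x - G₀ x| ∂μ) l (𝓝 0) := by
    simpa using hGlim.const_mul (|M| + 1)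
  filter_upwards [hD δ hδ, hlim.eventually_lt_const (half_pos hε)] with i hi hi2
  have hDi : ∀ᵐ x ∂μ, ‖D i x‖ ≤ |M| + 1 := by
    filter_upwards [hi, hM'] with x hx hx'
    have := abs_add_le (D i x - D₀ x) (D₀ x)
    rw [sub_add_cancel] at this
    rw [Real.norm_eq_abs]; linarith
  have hI1 : Integrable (fun x => D i x * G i x) μ := (hG i).bdd_mul (hDm i) hDi
  have hI2 : Integrable (fun x => D₀ x * G₀ x) μ := hG₀.bdd_mul hD₀m hM'
  rw [Real.dist_eq, ← integral_sub hI1 hI2]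
  refine (abs_integral_le_integral_abs).trans_lt ?_
  have hle : ∫ x, |D i x * G i x - D₀ x * G₀ x| ∂μ ≤
      ∫ x, ((|M| + 1) * |G i x - G₀ x| + δ * |G₀ x|) ∂μ := by
    refine integral_mono_ae (hI1.sub hI2).abs
      ((((hG i).sub hG₀).abs.const_mul _).add (hG₀.abs.const_mul _)) ?_
    filter_upwards [hi, hDi] with x hx hx'
    have e : D i x * G i x - D₀ x * G₀ x = D i x * (G i x - G₀ x) + (D i x - D₀ x) * G₀ x := by
      ring
    simp only [e]
    refine (abs_add_le _ _).trans ?_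
    rw [abs_mul, abs_mul]
    rw [Real.norm_eq_abs] at hx'
    gcongr
  have i1 : Integrable (fun x => (|M| + 1) * |G i x - G₀ x|) μ :=
    ((hG i).sub hG₀).abs.const_mul _
  rw [integral_add i1 (hG₀.abs.const_mul _), integral_const_mul, integral_const_mul] at hle
  linarith

/-- Hölder: an `L²` function times an `L²`-null family tends to zero in `L¹`. -/
theorem tendsto_integral_abs_mul_sub {g v : α → ℝ} {w : ι → α → ℝ} (hg : MemLp g 2 μ)
    (hv : MemLp v 2 μ) (hw : ∀ i, MemLp (w i) 2 μ)
    (h : Tendsto (fun i => eLpNorm (fun x => w i x - v x) 2 μ) l (𝓝 0)) :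
    Tendsto (fun i => ∫ x, |g x * (w i x - v x)| ∂μ) l (𝓝 0) := by
  have h1 : Tendsto (fun i => eLpNorm (g • fun x => w i x - v x) 1 μ) l (𝓝 0) := by
    have h2 : Tendsto (fun i => eLpNorm g 2 μ * eLpNorm (fun x => w i x - v x) 2 μ) l (𝓝 0) := by
      simpa using ENNReal.Tendsto.const_mul h (Or.inr hg.eLpNorm_ne_top)
    exact tendsto_of_tendsto_of_tendsto_of_le_of_le tendsto_const_nhds h2 (fun _ => zero_le)
      fun i => eLpNorm_smul_le_mul_eLpNorm ((hw i).sub hv).1 hg.1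
  have h3 := (ENNReal.tendsto_toReal ENNReal.zero_ne_top).comp h1
  refine h3.congr fun i => ?_
  have hm : AEStronglyMeasurable (fun x => g x * (w i x - v x)) μ := hg.1.mul ((hw i).sub hv).1
  have := integral_norm_eq_lintegral_enorm hm
  simp only [Real.norm_eq_abs] at this
  rw [this, Function.comp, eLpNorm_one_eq_lintegral_enorm]
  rfl

end UniformAE

/-! ### Superposition with `C¹` functions in `L^∞`, and contact with the bounds -/

section ChainRule

variable {θ θ' : ℝ → ℝ}

/-- First order Taylor expansion of a `C¹` function, uniformly on the unit interval. -/
theorem exists_taylor_Icc (hθ : ∀ r, HasDerivAt θ (θ' r) r) (hc : Continuous θ') {ε : ℝ}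
    (hε : 0 < ε) : ∃ δ > 0, ∀ a ∈ Icc (0 : ℝ) 1, ∀ b ∈ Icc (0 : ℝ) 1, |b - a| ≤ δ →
      |θ b - θ a - θ' a * (b - a)| ≤ ε * |b - a| := by
  have huc := (isCompact_Icc (a := (0 : ℝ)) (b := 1)).uniformContinuousOn_of_continuous
    hc.continuousOn
  obtain ⟨δ, hδ, h⟩ := Metric.uniformContinuousOn_iff.1 huc ε hε
  refine ⟨δ / 2, half_pos hδ, fun a ha b hb hab => ?_⟩
  have hsub : uIcc a b ⊆ Icc 0 1 := ordConnected_Icc.uIcc_subset ha hb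
  -- Mean value inequality for `θ r - θ' a * r`, whose derivative is at most `ε` between `a` and `b`
  -- by uniform continuity of `θ'`.
  have key := Convex.norm_image_sub_le_of_norm_hasDerivWithin_le
    (f := fun r => θ r - θ' a * r) (f' := fun r => θ' r - θ' a) (s := uIcc a b) (C := ε)
    (x := a) (y := b)
    (fun r _ => by
      have h1 : HasDerivAt (fun r => θ r - θ' a * r) (θ' r - θ' a * 1) r :=
        (hθ r).sub ((hasDerivAt_id r).const_mul (θ' a))
      rw [mul_one] at h1
      exact h1.hasDerivWithinAt)
    (fun r hr => by
      have h1 : |r - a| ≤ |b - a| := abs_sub_left_of_mem_uIcc hr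
      have := h r (hsub hr) a ha (by rw [Real.dist_eq]; linarith)
      rw [Real.dist_eq] at this
      exact this.le)
    (convex_uIcc a b) left_mem_uIcc right_mem_uIcc
  simp only [Real.norm_eq_abs] at key
  convert key using 2
  ring

variable {α : Type*} [MeasurableSpace α] {μ : Measure α} {f : ℝ → α → ℝ} {f₀ f' : α → ℝ}

/-- Differentiability in `L^∞` of the superposition with a `C¹` function. -/
theorem TendstoUniformlyAE.slope_comp (hθ : ∀ r, HasDerivAt θ (θ' r) r) (hc : Continuous θ')
    {M : ℝ} (hM : ∀ᵐ x ∂μ, |f' x| ≤ M) (hf₀ : ∀ᵐ x ∂μ, f₀ x ∈ Icc (0 : ℝ) 1)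
    (hf : ∀ᶠ h in 𝓝[≠] (0 : ℝ), ∀ᵐ x ∂μ, f h x ∈ Icc (0 : ℝ) 1)
    (hd : TendstoUniformlyAE μ (fun h x => h⁻¹ * (f h x - f₀ x)) f' (𝓝[≠] 0)) :
    TendstoUniformlyAE μ (fun h x => h⁻¹ * (θ (f h x) - θ (f₀ x)))
      (fun x => θ' (f₀ x) * f' x) (𝓝[≠] 0) := by
  intro ε hε
  obtain ⟨K, hK⟩ := (isCompact_Icc (a := (0 : ℝ)) (b := 1)).exists_bound_of_continuousOn
    hc.continuousOn
  have hM' : ∀ᵐ x ∂μ, |f' x| ≤ |M| := hM.mono fun x hx => hx.trans (le_abs_self M)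
  have hK' : ∀ a ∈ Icc (0 : ℝ) 1, |θ' a| ≤ |K| := fun a ha => (hK a ha).trans (le_abs_self K)
  have hM0 := abs_nonneg M
  have hK0 := abs_nonneg K
  -- The Taylor remainder will be multiplied by a difference quotient of size at most `|M| + 1`;
  -- this tolerance leaves `ε / 2`.
  obtain ⟨δ, hδ, hT⟩ := exists_taylor_Icc hθ hc (ε := ε / (2 * (|M| + 1))) (by positivity)
  have hsmall : ∀ᶠ h in 𝓝[≠] (0 : ℝ), |h| * (|M| + 1) < δ := by
    have : Tendsto (fun h : ℝ => |h| * (|M| + 1)) (𝓝[≠] 0) (𝓝 0) := by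
      have : Continuous fun h : ℝ => |h| * (|M| + 1) := by fun_prop
      simpa using (this.tendsto 0).mono_left nhdsWithin_le_nhds
    exact this.eventually_lt_const hδ
  filter_upwards [hf, hd (min 1 (ε / (2 * (|K| + 1)))) (by positivity), hsmall,
    self_mem_nhdsWithin] with h h1 h2 h3 h4
  have hne : h ≠ 0 := h4
  filter_upwards [hM', hf₀, h1, h2] with x hx0 hx1 hx2 hx3
  set q := h⁻¹ * (f h x - f₀ x) with hq
  have hqe : f h x - f₀ x = h * q := by rw [hq]; field_simp
  have hqM : |q| ≤ |M| + 1 := by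
    have := abs_add_le (q - f' x) (f' x)
    rw [sub_add_cancel] at this
    linarith [min_le_left (1 : ℝ) (ε / (2 * (|K| + 1)))]
  have hT' := hT _ hx1 _ hx2 (by
    rw [hqe, abs_mul]
    exact (mul_le_mul_of_nonneg_left hqM (abs_nonneg h)).trans h3.le)
  rw [hqe, abs_mul] at hT'
  -- Taylor remainder, plus the error of the quotient `q` weighted by the bounded factor `θ' (f₀
  -- x)`.
  have e : h⁻¹ * (θ (f h x) - θ (f₀ x)) - θ' (f₀ x) * f' x =
      h⁻¹ * (θ (f h x) - θ (f₀ x) - θ' (f₀ x) * (h * q)) + θ' (f₀ x) * (q - f' x) := by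
    field_simp; ring
  rw [e]
  refine (abs_add_le _ _).trans ?_
  rw [abs_mul, abs_mul, abs_inv]
  have b1 : |h|⁻¹ * |θ (f h x) - θ (f₀ x) - θ' (f₀ x) * (h * q)| ≤ ε / 2 := by
    calc _ ≤ |h|⁻¹ * (ε / (2 * (|M| + 1)) * (|h| * |q|)) := by gcongr
      _ = ε / (2 * (|M| + 1)) * |q| := by
        have := abs_pos.2 hne
        field_simp
      _ ≤ ε / (2 * (|M| + 1)) * (|M| + 1) := by gcongr
      _ = ε / 2 := by field_simp
  have b2 : |θ' (f₀ x)| * |q - f' x| ≤ ε / 2 := by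
    calc _ ≤ |K| * (ε / (2 * (|K| + 1))) := by
          exact mul_le_mul (hK' _ hx1) (hx3.trans (min_le_right _ _)) (abs_nonneg _) hK0
      _ ≤ (|K| + 1) * (ε / (2 * (|K| + 1))) := by gcongr; linarith
      _ = ε / 2 := by field_simp
  linarith

/-- Differentiability implies continuity, for uniform convergence almost everywhere. -/
theorem TendstoUniformlyAE.of_slope {M : ℝ} (hM : ∀ᵐ x ∂μ, |f' x| ≤ M)
    (hd : TendstoUniformlyAE μ (fun h x => h⁻¹ * (f h x - f₀ x)) f' (𝓝[≠] 0)) :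
    TendstoUniformlyAE μ f f₀ (𝓝[≠] 0) := by
  intro ε hε
  have hsmall : ∀ᶠ h in 𝓝[≠] (0 : ℝ), |h| * (|M| + 1) < ε := by
    have : Tendsto (fun h : ℝ => |h| * (|M| + 1)) (𝓝[≠] 0) (𝓝 0) := by
      have : Continuous fun h : ℝ => |h| * (|M| + 1) := by fun_prop
      simpa using (this.tendsto 0).mono_left nhdsWithin_le_nhds
    exact this.eventually_lt_const hε
  filter_upwards [hd 1 one_pos, hsmall, self_mem_nhdsWithin] with h h2 h3 h4
  have hne : h ≠ 0 := h4
  filter_upwards [hM, h2] with x hx0 hx3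
  set q := h⁻¹ * (f h x - f₀ x) with hq
  have hqe : f h x - f₀ x = h * q := by rw [hq]; field_simp
  have hqM : |q| ≤ |M| + 1 := by
    have := abs_add_le (q - f' x) (f' x)
    rw [sub_add_cancel] at this
    linarith [le_abs_self M]
  rw [hqe, abs_mul]
  exact (mul_le_mul_of_nonneg_left hqM (abs_nonneg h)).trans h3.le

/-- A curve with values in `[0, 1]` has zero derivative where it touches the bounds. -/
theorem TendstoUniformlyAE.eq_zero_of_mem_bounds
    (hf : ∀ᶠ h in 𝓝[≠] (0 : ℝ), ∀ᵐ x ∂μ, f h x ∈ Icc (0 : ℝ) 1)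
    (hd : TendstoUniformlyAE μ (fun h x => h⁻¹ * (f h x - f₀ x)) f' (𝓝[≠] 0)) :
    ∀ᵐ x ∂μ, f₀ x * (1 - f₀ x) = 0 → f' x = 0 := by
  -- At a bound the increment has a fixed sign, so quotients with positive and negative step have
  -- opposite signs. Both lie within `1 / (n + 1)` of `f' x`, which is therefore that small. One
  -- step of each sign per `n` keeps the exceptional null sets countable in number.
  have hright : 𝓝[>] (0 : ℝ) ≤ 𝓝[≠] 0 := nhdsWithin_mono _ fun x (hx : 0 < x) => hx.ne'
  have hleft : 𝓝[<] (0 : ℝ) ≤ 𝓝[≠] 0 := nhdsWithin_mono _ fun x (hx : x < 0) => hx.ne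
  have hn : ∀ n : ℕ, ∀ᵐ x ∂μ, f₀ x * (1 - f₀ x) = 0 → |f' x| ≤ 1 / ((n : ℝ) + 1) := by
    intro n
    have hp : (0 : ℝ) < 1 / ((n : ℝ) + 1) := by positivity
    obtain ⟨a, ha1, ha2, ha3⟩ := ((hf.filter_mono hright).and
      (((hd _ hp).filter_mono hright).and self_mem_nhdsWithin)).exists
    obtain ⟨b, hb1, hb2, hb3⟩ := ((hf.filter_mono hleft).and
      (((hd _ hp).filter_mono hleft).and self_mem_nhdsWithin)).exists
    have ha : 0 < a⁻¹ := inv_pos.2 ha3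
    have hb : b⁻¹ < 0 := inv_lt_zero.2 hb3
    filter_upwards [ha1, ha2, hb1, hb2] with x h1 h2 h3 h4 h0
    rw [abs_le] at h2 h4 ⊢
    rcases mul_eq_zero.1 h0 with h0 | h0
    · rw [h0, sub_zero] at h2 h4
      have i1 := mul_nonneg ha.le h1.1
      have i2 := mul_nonpos_of_nonpos_of_nonneg hb.le h3.1
      constructor <;> linarith
    · have h0' : f₀ x = 1 := by linarith
      rw [h0'] at h2 h4
      have i1 := mul_nonpos_of_nonneg_of_nonpos ha.le (sub_nonpos.2 h1.2)
      have i2 := mul_nonneg_of_nonpos_of_nonpos hb.le (sub_nonpos.2 h3.2)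
      constructor <;> linarith
  filter_upwards [ae_all_iff.2 hn] with x hx h0
  have h1 : |f' x| ≤ 0 := ge_of_tendsto' tendsto_one_div_add_atTop_nhds_zero_nat
    fun n => hx n h0
  exact abs_nonpos_iff.1 h1

end ChainRule

/-! ### Differentiating the Dirichlet energy -/

section GradientNorm

variable {α E : Type*} [MeasurableSpace α] {μ : Measure α} [NormedAddCommGroup E]
  [InnerProductSpace ℝ E]

/-- Derivative of the squared `L²` norm along a differentiable curve. -/
theorem hasDerivAt_integral_norm_sq {g : ℝ → α → E} {g' : α → E} {t : ℝ}
    (hg : ∀ τ, MemLp (g τ) 2 μ) (hg' : MemLp g' 2 μ)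
    (h : Tendsto (fun s : ℝ => eLpNorm (fun x => s⁻¹ • (g (t + s) x - g t x) - g' x) 2 μ)
      (𝓝[≠] 0) (𝓝 0)) :
    HasDerivAt (fun τ => ∫ x, ‖g τ x‖ ^ 2 ∂μ) (2 * ∫ x, inner ℝ (g t x) (g' x) ∂μ) t := by
  have hL : HasDerivAt (fun τ => (hg τ).toLp (g τ)) (hg'.toLp g') t := by
    -- The hypothesis is exactly convergence of the slopes in the Hilbert space `L²`, where the
    -- squared norm is differentiable.
    rw [hasDerivAt_iff_tendsto_slope_zero]
    have := (Lp.tendsto_Lp_iff_tendsto_eLpNorm'' (fi := 𝓝[≠] (0 : ℝ))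
      (fun s : ℝ => s⁻¹ • (g (t + s) - g t)) (fun s => ((hg _).sub (hg _)).const_smul _)
      g' hg').2 h
    exact this
  have h2 := hL.norm_sq
  have e1 : ∀ {a b : α → E} (ha : MemLp a 2 μ) (hb : MemLp b 2 μ),
      inner ℝ (ha.toLp a) (hb.toLp b) = ∫ x, inner ℝ (a x) (b x) ∂μ := by
    intro a b ha hb
    rw [L2.inner_def]
    refine integral_congr_ae ?_
    filter_upwards [ha.coeFn_toLp, hb.coeFn_toLp] with x h1 h2
    rw [h1, h2]
  rw [e1] at h2
  convert h2 using 2 with τ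
  rw [← real_inner_self_eq_norm_sq, e1]
  simp only [real_inner_self_eq_norm_sq]

end GradientNorm

/-! ### Algebra of the stiffness form -/

section Tensor

variable {d : ℕ}

theorem ddot_comm (A B : Matrix (Fin d) (Fin d) ℝ) : ddot A B = ddot B A := by
  simp only [ddot, mul_comm]

theorem ddot_sub_left (A B W : Matrix (Fin d) (Fin d) ℝ) :
    ddot (A - B) W = ddot A W - ddot B W := by
  simp only [ddot, Matrix.sub_apply, sub_mul, Finset.sum_sub_distrib]

theorem ddot_add_left (A B W : Matrix (Fin d) (Fin d) ℝ) :
    ddot (A + B) W = ddot A W + ddot B W := by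
  simp only [ddot, Matrix.add_apply, add_mul, Finset.sum_add_distrib]

theorem ddot_smul_left (c : ℝ) (A W : Matrix (Fin d) (Fin d) ℝ) :
    ddot (c • A) W = c * ddot A W := by
  simp only [ddot, Matrix.smul_apply, smul_eq_mul, Finset.mul_sum, mul_assoc]

theorem ddot_sub_right (A B W : Matrix (Fin d) (Fin d) ℝ) :
    ddot W (A - B) = ddot W A - ddot W B := by
  rw [ddot_comm, ddot_sub_left, ddot_comm A, ddot_comm B]

theorem ddot_add_right (A B W : Matrix (Fin d) (Fin d) ℝ) :
    ddot W (A + B) = ddot W A + ddot W B := by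
  rw [ddot_comm, ddot_add_left, ddot_comm A, ddot_comm B]

theorem ddot_smul_right (c : ℝ) (A W : Matrix (Fin d) (Fin d) ℝ) :
    ddot W (c • A) = c * ddot W A := by
  rw [ddot_comm, ddot_smul_left, ddot_comm A]

variable {C : Matrix (Fin d) (Fin d) ℝ →ₗ[ℝ] Matrix (Fin d) (Fin d) ℝ}
  {A W : Matrix (Fin d) (Fin d) ℝ}

theorem IsStiffnessTensor.ddot_map_comm (hC : IsStiffnessTensor C) (hA : A.IsSymm)
    (hW : W.IsSymm) : ddot (C A) W = ddot (C W) A := by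
  rw [hC.major A W hA hW, ddot_comm]

theorem IsStiffnessTensor.ddot_map_self_nonneg (hC : IsStiffnessTensor C) (hA : A.IsSymm) :
    0 ≤ ddot (C A) A := by
  by_cases h : A = 0
  · simp [h, ddot]
  · exact (hC.pos A hA h).le

/-- Young's inequality for the energy form. -/
theorem IsStiffnessTensor.abs_ddot_map_le (hC : IsStiffnessTensor C) (hA : A.IsSymm)
    (hW : W.IsSymm) {δ : ℝ} (hδ : 0 < δ) :
    |ddot (C A) W| ≤ (δ * ddot (C A) A + ddot (C W) W / δ) / 2 := by
  -- Nonnegativity of the form at `δA + W` and `δA - W` yields the two signs of the inequality.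
  have h1 := hC.ddot_map_self_nonneg (A := δ • A + W) ((hA.smul δ).add hW)
  have h2 := hC.ddot_map_self_nonneg (A := δ • A - W) ((hA.smul δ).sub hW)
  rw [map_add, map_smul, ddot_add_left, ddot_smul_left, ddot_add_right, ddot_smul_right,
    ddot_add_right, ddot_smul_right, hC.ddot_map_comm hW hA] at h1
  rw [map_sub, map_smul, ddot_sub_left, ddot_smul_left, ddot_sub_right, ddot_smul_right,
    ddot_sub_right, ddot_smul_right, hC.ddot_map_comm hW hA] at h2
  have e : (δ * ddot (C A) A + ddot (C W) W / δ) / 2 =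
      (δ * (δ * ddot (C A) A) + ddot (C W) W) / (2 * δ) := by field_simp
  rw [e, abs_le, ← neg_div, div_le_iff₀ (by positivity), le_div_iff₀ (by positivity)]
  constructor <;> linarith

end Tensor

/-! ### Regularity of the interpolation and of the double well -/

section Interpolation

variable {m p r : ℝ}

theorem interp_mem_Icc (hm : m ∈ Ioo (0 : ℝ) 1) (hp : 1 ≤ p) (hr : r ∈ Icc (0 : ℝ) 1) :
    interp m p r ∈ Icc m 1 := by
  have h0 := Real.rpow_nonneg hr.1 p
  have h1 := Real.rpow_le_one hr.1 hr.2 (by linarith : 0 ≤ p)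
  have hm' : 0 ≤ 1 - m := by linarith [hm.2]
  constructor
  · have := mul_nonneg hm' h0
    unfold interp; linarith
  · have := mul_le_mul_of_nonneg_left h1 hm'
    unfold interp; linarith

/-- The assumption `1 ≤ p` makes the real power differentiable at 0 as well, so the chain rule
applies where `φ` vanishes. -/
theorem hasDerivAt_interp (hp : 1 ≤ p) (r : ℝ) :
    HasDerivAt (interp m p) ((1 - m) * (p * r ^ (p - 1))) r :=
  ((Real.hasDerivAt_rpow_const (Or.inr hp)).const_mul (1 - m)).const_add m

theorem continuous_deriv_interp (hp : 1 ≤ p) : Continuous (deriv (interp m p)) := by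
  have : deriv (interp m p) = fun r => (1 - m) * (p * r ^ (p - 1)) :=
    funext fun r => (hasDerivAt_interp hp r).deriv
  rw [this]
  exact continuous_const.mul (continuous_const.mul
    (Real.continuous_rpow_const (by linarith)))

theorem differentiable_interp (hp : 1 ≤ p) : Differentiable ℝ (interp m p) :=
  fun r => (hasDerivAt_interp hp r).differentiableAt

theorem contDiff_well : ContDiff ℝ 1 well := by
  unfold well; fun_prop

theorem continuous_deriv_well : Continuous (deriv well) :=
  contDiff_well.continuous_deriv le_rfl

theorem differentiable_well : Differentiable ℝ well := contDiff_well.differentiable one_ne_zero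

end Interpolation

/-! ### Compliance increments and stability of the elastic state -/

section Elasticity

variable {d : ℕ} {P : Data d}

theorem Displacement.strain_isSymm (u : Displacement P) (x : Pt d) : (u.strain x).IsSymm := by
  ext i j
  simp [Displacement.strain, add_comm]

/-- The energy density `E⁰ ε(u) : ε(v)`. -/
noncomputable def energyDensity (u v : Displacement P) (x : Pt d) : ℝ :=
  ddot (P.E0 (u.strain x)) (v.strain x)

/-- The energy density of the difference of two displacements. -/
noncomputable def energyGap (u v : Displacement P) (x : Pt d) : ℝ :=
  ddot (P.E0 (u.strain x - v.strain x)) (u.strain x - v.strain x)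

theorem energyDensity_comm (u v : Displacement P) (x : Pt d) :
    energyDensity u v x = energyDensity v u x :=
  P.stiffness.ddot_map_comm (u.strain_isSymm x) (v.strain_isSymm x)

theorem energyDensity_self_nonneg (u : Displacement P) (x : Pt d) : 0 ≤ energyDensity u u x :=
  P.stiffness.ddot_map_self_nonneg (u.strain_isSymm x)

theorem energyGap_nonneg (u v : Displacement P) (x : Pt d) : 0 ≤ energyGap u v x :=
  P.stiffness.ddot_map_self_nonneg ((u.strain_isSymm x).sub (v.strain_isSymm x))

theorem energyGap_eq (u v : Displacement P) (x : Pt d) :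
    energyGap u v x = energyDensity u u x - 2 * energyDensity u v x + energyDensity v v x := by
  have := energyDensity_comm u v x
  simp only [energyGap, energyDensity, map_sub, ddot_sub_left, ddot_sub_right] at *
  linarith

theorem abs_energyDensity_sub_le (u v : Displacement P) (x : Pt d) {δ : ℝ} (hδ : 0 < δ) :
    |energyDensity u v x - energyDensity v v x| ≤
      (δ * energyDensity v v x + energyGap u v x / δ) / 2 := by
  rw [energyDensity_comm u v]
  have := P.stiffness.abs_ddot_map_le (v.strain_isSymm x)
    ((u.strain_isSymm x).sub (v.strain_isSymm x)) hδ
  rwa [ddot_sub_right] at this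

theorem Displacement.memLp_strain (u : Displacement P) (i j : Fin d) :
    MemLp (fun x => u.strain x i j) 2 (volume.restrict P.Ω) := by
  have h (i j : Fin d) : MemLp (fun x => (u.comp i).grad x j) 2 (volume.restrict P.Ω) :=
    (EuclideanSpace.proj (𝕜 := ℝ) j).comp_memLp' (u.comp i).memLp_grad
  refine (((h i j).add (h j i)).const_mul (2 : ℝ)⁻¹).ae_eq (Eventually.of_forall fun x => ?_)
  simp only [Displacement.strain, Matrix.of_apply, Pi.add_apply]
  ring

theorem integrable_energyDensity (u v : Displacement P) :
    Integrable (energyDensity u v) (volume.restrict P.Ω) := by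
  have h (i j : Fin d) : MemLp (fun x => P.E0 (u.strain x) i j) 2 (volume.restrict P.Ω) := by
    -- Expanding the strain in matrix units makes each stress entry a finite linear combination of
    -- `L²` functions.
    have e : (fun x => P.E0 (u.strain x) i j) = fun x =>
        ∑ k, ∑ l, P.E0 (Matrix.single k l 1) i j * u.strain x k l := by
      funext x
      conv_lhs => rw [Matrix.matrix_eq_sum_single (u.strain x)]
      simp only [map_sum, Matrix.sum_apply]
      refine Finset.sum_congr rfl fun k _ => Finset.sum_congr rfl fun l _ => ?_
      have : Matrix.single k l (u.strain x k l) =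
          u.strain x k l • Matrix.single k l (1 : ℝ) := by simp
      rw [this, map_smul, Matrix.smul_apply, smul_eq_mul, mul_comm]
    rw [e]
    exact memLp_finsetSum _ fun k _ => memLp_finsetSum _ fun l _ =>
      (u.memLp_strain k l).const_mul _
  unfold energyDensity ddot
  exact integrable_finsetSum _ fun i _ => integrable_finsetSum _ fun j _ =>
    (h i j).integrable_mul (v.memLp_strain i j)

theorem integrable_energyGap (u v : Displacement P) :
    Integrable (energyGap u v) (volume.restrict P.Ω) := by
  have : energyGap u v = fun x =>
      energyDensity u u x - 2 * energyDensity u v x + energyDensity v v x :=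
    funext (energyGap_eq u v)
  rw [this]
  exact ((integrable_energyDensity u u).sub ((integrable_energyDensity u v).const_mul 2)).add
    (integrable_energyDensity v v)

theorem Data.memLp_f0_apply (P : Data d) (i : Fin d) :
    MemLp (fun x => P.f0 x i) 2 (volume.restrict P.Ω) :=
  (EuclideanSpace.proj (𝕜 := ℝ) i).comp_memLp' P.memLp_f0

theorem Displacement.integrable_f0dot (u : Displacement P) :
    Integrable u.f0dot (volume.restrict P.Ω) :=
  integrable_finsetSum _ fun i _ => (P.memLp_f0_apply i).integrable_mul (u.comp i).memLp_val

theorem tendsto_integral_abs_f0dot_sub {ι : Type*} {l : Filter ι} {w : ι → Displacement P}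
    {u : Displacement P} (h : ∀ i, Tendsto
      (fun n => eLpNorm (fun x => ((w n).comp i).val x - (u.comp i).val x) 2
        (volume.restrict P.Ω)) l (𝓝 0)) :
    Tendsto (fun n => ∫ x in P.Ω, |(w n).f0dot x - u.f0dot x|) l (𝓝 0) := by
  have hi (n : ι) (i : Fin d) : Integrable
      (fun x => |P.f0 x i * (((w n).comp i).val x - (u.comp i).val x)|) (volume.restrict P.Ω) :=
    ((P.memLp_f0_apply i).integrable_mul
      (((w n).comp i).memLp_val.sub (u.comp i).memLp_val)).abs
  have h1 : Tendsto (fun n => ∑ i, ∫ x in P.Ω,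
      |P.f0 x i * (((w n).comp i).val x - (u.comp i).val x)|) l (𝓝 0) := by
    have := tendsto_finsetSum Finset.univ fun i _ => tendsto_integral_abs_mul_sub
      (P.memLp_f0_apply i) (u.comp i).memLp_val (fun n => ((w n).comp i).memLp_val) (h i)
    simpa using this
  refine tendsto_of_tendsto_of_tendsto_of_le_of_le tendsto_const_nhds h1
    (fun n => integral_nonneg fun x => abs_nonneg _) fun n => ?_
  dsimp only
  rw [← integral_finsetSum _ fun i _ => hi n i]
  refine integral_mono ((w n).integrable_f0dot.sub u.integrable_f0dot).abs
    (integrable_finsetSum _ fun i _ => hi n i) fun x => ?_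
  have e : (w n).f0dot x - u.f0dot x =
      ∑ i, P.f0 x i * (((w n).comp i).val x - (u.comp i).val x) := by
    simp only [Displacement.f0dot, mul_sub, Finset.sum_sub_distrib]
  dsimp only
  rw [e]
  exact Finset.abs_sum_le_sum_abs _ _

/-- The pointwise bounds `0 ≤ φ ≤ 1` of an admissible phase field. -/
def InUnitInterval (P : Data d) (φ : H1 P.Ω) : Prop :=
  ∀ᵐ x ∂(volume.restrict P.Ω), φ.val x ∈ Icc (0 : ℝ) 1

theorem Data.aestronglyMeasurable_comp {θ : ℝ → ℝ} (hθ : Continuous θ) (φ : H1 P.Ω) :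
    AEStronglyMeasurable (fun x => θ (φ.val x)) (volume.restrict P.Ω) :=
  hθ.comp_aestronglyMeasurable φ.memLp_val.1

theorem Data.differentiable_Efac (P : Data d) : Differentiable ℝ P.Efac :=
  differentiable_interp P.one_le_p

theorem Data.differentiable_ffac (P : Data d) : Differentiable ℝ P.ffac :=
  differentiable_interp P.one_le_p

theorem Data.continuous_deriv_Efac (P : Data d) : Continuous (deriv P.Efac) :=
  continuous_deriv_interp P.one_le_p

theorem Data.continuous_deriv_ffac (P : Data d) : Continuous (deriv P.ffac) :=
  continuous_deriv_interp P.one_le_p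

/-- Composing with a continuous function preserves integrability of products. -/
theorem InUnitInterval.integrable_mul {φ : H1 P.Ω} (hφ : InUnitInterval P φ) {θ : ℝ → ℝ}
    (hθ : Continuous θ) {g : Pt d → ℝ} (hg : Integrable g (volume.restrict P.Ω)) :
    Integrable (fun x => θ (φ.val x) * g x) (volume.restrict P.Ω) := by
  obtain ⟨K, hK⟩ := (isCompact_Icc (a := (0 : ℝ)) (b := 1)).exists_bound_of_continuousOn
    hθ.continuousOn
  exact hg.bdd_mul (Data.aestronglyMeasurable_comp hθ φ) (hφ.mono fun x hx => hK _ hx)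

variable {φ φ₁ : H1 P.Ω} {u u₁ : Displacement P}

/-- The traction does not depend on the phase field, so the boundary integrals cancel. -/
theorem load_sub_load (hφ : InUnitInterval P φ) (hφ₁ : InUnitInterval P φ₁)
    (v : Displacement P) : load P φ₁ v - load P φ v =
      ∫ x in P.Ω, (P.ffac (φ₁.val x) - P.ffac (φ.val x)) * v.f0dot x := by
  have hc := P.differentiable_ffac.continuous
  simp only [sub_mul]
  rw [integral_sub (hφ₁.integrable_mul hc v.integrable_f0dot)
    (hφ.integrable_mul hc v.integrable_f0dot), load, load]
  ring

theorem IsState.integral_eq (hu : IsState P φ u) (v : Displacement P) :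
    ∫ x in P.Ω, P.Efac (φ.val x) * energyDensity u v x = load P φ v := hu v

theorem integrable_Efac_sub_mul (hφ : InUnitInterval P φ) (hφ₁ : InUnitInterval P φ₁)
    {g : Pt d → ℝ} (hg : Integrable g (volume.restrict P.Ω)) :
    Integrable (fun x => (P.Efac (φ₁.val x) - P.Efac (φ.val x)) * g x)
      (volume.restrict P.Ω) := by
  have hc := P.differentiable_Efac.continuous
  simp only [sub_mul]
  exact (hφ₁.integrable_mul hc hg).sub (hφ.integrable_mul hc hg)

theorem integrable_ffac_sub_mul (hφ : InUnitInterval P φ) (hφ₁ : InUnitInterval P φ₁)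
    {g : Pt d → ℝ} (hg : Integrable g (volume.restrict P.Ω)) :
    Integrable (fun x => (P.ffac (φ₁.val x) - P.ffac (φ.val x)) * g x)
      (volume.restrict P.Ω) := by
  have hc := P.differentiable_ffac.continuous
  simp only [sub_mul]
  exact (hφ₁.integrable_mul hc hg).sub (hφ.integrable_mul hc hg)

theorem integral_Efac_sub_mul (hφ : InUnitInterval P φ) (hφ₁ : InUnitInterval P φ₁)
    {g : Pt d → ℝ} (hg : Integrable g (volume.restrict P.Ω)) :
    ∫ x in P.Ω, (P.Efac (φ₁.val x) - P.Efac (φ.val x)) * g x =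
      (∫ x in P.Ω, P.Efac (φ₁.val x) * g x) - ∫ x in P.Ω, P.Efac (φ.val x) * g x := by
  have hc := P.differentiable_Efac.continuous
  simp only [sub_mul]
  exact integral_sub (hφ₁.integrable_mul hc hg) (hφ.integrable_mul hc hg)

/-- The symmetric formula for the increment of the compliance. -/
theorem compliance_sub (hφ : InUnitInterval P φ) (hφ₁ : InUnitInterval P φ₁)
    (hu : IsState P φ u) (hu₁ : IsState P φ₁ u₁) : load P φ₁ u₁ - load P φ u =
      (∫ x in P.Ω, (P.ffac (φ₁.val x) - P.ffac (φ.val x)) * u₁.f0dot x) +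
      (∫ x in P.Ω, (P.ffac (φ₁.val x) - P.ffac (φ.val x)) * u.f0dot x) -
      ∫ x in P.Ω, (P.Efac (φ₁.val x) - P.Efac (φ.val x)) * energyDensity u₁ u x := by
  rw [← load_sub_load hφ hφ₁, ← load_sub_load hφ hφ₁,
    integral_Efac_sub_mul hφ hφ₁ (integrable_energyDensity u₁ u), hu₁.integral_eq u]
  -- The symmetry of `E0` turns this into the state equation for `u` tested with `u₁`.
  have : ∫ x in P.Ω, P.Efac (φ.val x) * energyDensity u₁ u x = load P φ u₁ := by
    simp only [energyDensity_comm u₁ u]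
    exact hu.integral_eq u₁
  rw [this]
  ring

/-- This is the difference of the two state equations tested with `u₁ - u`. Expanding the square
reduces it to the test functions `u₁` and `u`, so `u₁ - u` need not be built as a displacement with
a trace. -/
theorem integral_Efac_energyGap (hφ : InUnitInterval P φ) (hφ₁ : InUnitInterval P φ₁)
    (hu : IsState P φ u) (hu₁ : IsState P φ₁ u₁) :
    ∫ x in P.Ω, P.Efac (φ₁.val x) * energyGap u₁ u x =
      (∫ x in P.Ω, (P.ffac (φ₁.val x) - P.ffac (φ.val x)) * (u₁.f0dot x - u.f0dot x)) -
      ∫ x in P.Ω, (P.Efac (φ₁.val x) - P.Efac (φ.val x)) *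
        (energyDensity u₁ u x - energyDensity u u x) := by
  have hc := P.differentiable_Efac.continuous
  have i11 := hφ₁.integrable_mul hc (integrable_energyDensity u₁ u₁)
  have i1 := hφ₁.integrable_mul hc (integrable_energyDensity u₁ u)
  have i0 := hφ₁.integrable_mul hc (integrable_energyDensity u u)
  have s0 : ∫ x in P.Ω, P.Efac (φ.val x) * energyDensity u₁ u x = load P φ u₁ := by
    simp only [energyDensity_comm u₁ u]
    exact hu.integral_eq u₁
  have hL : ∫ x in P.Ω, P.Efac (φ₁.val x) * energyGap u₁ u x =
      load P φ₁ u₁ - 2 * load P φ₁ u +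
        ∫ x in P.Ω, P.Efac (φ₁.val x) * energyDensity u u x := by
    have i2 : Integrable (fun x => P.Efac (φ₁.val x) * energyDensity u₁ u₁ x -
        2 * (P.Efac (φ₁.val x) * energyDensity u₁ u x)) (volume.restrict P.Ω) :=
      i11.sub (i1.const_mul 2)
    rw [← hu₁.integral_eq u₁, ← hu₁.integral_eq u, ← integral_const_mul,
      ← integral_sub i11 (i1.const_mul 2), ← integral_add i2 i0]
    refine integral_congr_ae (Eventually.of_forall fun x => ?_)
    simp only [energyGap_eq]
    ring
  rw [hL]
  simp only [mul_sub]
  rw [integral_sub (integrable_ffac_sub_mul hφ hφ₁ u₁.integrable_f0dot)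
      (integrable_ffac_sub_mul hφ hφ₁ u.integrable_f0dot),
    integral_sub (integrable_Efac_sub_mul hφ hφ₁ (integrable_energyDensity u₁ u))
      (integrable_Efac_sub_mul hφ hφ₁ (integrable_energyDensity u u)),
    ← load_sub_load hφ hφ₁, ← load_sub_load hφ hφ₁,
    integral_Efac_sub_mul hφ hφ₁ (integrable_energyDensity u₁ u),
    integral_Efac_sub_mul hφ hφ₁ (integrable_energyDensity u u), hu₁.integral_eq u, s0,
    hu.integral_eq u]
  ring

/-- Stability of the state: the strain energy of `u₁ - u` is controlled by the perturbation of the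
coefficients. -/
theorem integral_energyGap_le (hφ : InUnitInterval P φ) (hφ₁ : InUnitInterval P φ₁)
    (hu : IsState P φ u) (hu₁ : IsState P φ₁ u₁) {δ : ℝ}
    (hE : ∀ᵐ x ∂(volume.restrict P.Ω), |P.Efac (φ₁.val x) - P.Efac (φ.val x)| ≤ δ)
    (hf : ∀ᵐ x ∂(volume.restrict P.Ω), |P.ffac (φ₁.val x) - P.ffac (φ.val x)| ≤ δ) :
    P.Emin * ∫ x in P.Ω, energyGap u₁ u x ≤
      δ * (∫ x in P.Ω, |u₁.f0dot x - u.f0dot x|) +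
      δ * (((∫ x in P.Ω, energyDensity u u x) + ∫ x in P.Ω, energyGap u₁ u x) / 2) := by
  have hgap := integrable_energyGap u₁ u
  have hd := u₁.integrable_f0dot.sub u.integrable_f0dot
  have he := (integrable_energyDensity u₁ u).sub (integrable_energyDensity u u)
  have huu := integrable_energyDensity u u
  have h1 : P.Emin * ∫ x in P.Ω, energyGap u₁ u x ≤
      ∫ x in P.Ω, P.Efac (φ₁.val x) * energyGap u₁ u x := by
    rw [← integral_const_mul]
    refine integral_mono_ae (hgap.const_mul _)
      (hφ₁.integrable_mul P.differentiable_Efac.continuous hgap) ?_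
    filter_upwards [hφ₁] with x hx
    exact mul_le_mul_of_nonneg_right (interp_mem_Icc P.Emin_mem P.one_le_p hx).1
      (energyGap_nonneg u₁ u x)
  have h2 : ∫ x in P.Ω, (P.ffac (φ₁.val x) - P.ffac (φ.val x)) * (u₁.f0dot x - u.f0dot x) ≤
      δ * ∫ x in P.Ω, |u₁.f0dot x - u.f0dot x| := by
    rw [← integral_const_mul]
    refine integral_mono_ae (integrable_ffac_sub_mul hφ hφ₁ hd) (hd.abs.const_mul _) ?_
    filter_upwards [hf] with x hx
    refine (le_abs_self _).trans ?_
    rw [abs_mul]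
    exact mul_le_mul_of_nonneg_right hx (abs_nonneg _)
  have h3 : -∫ x in P.Ω, (P.Efac (φ₁.val x) - P.Efac (φ.val x)) *
        (energyDensity u₁ u x - energyDensity u u x) ≤
      δ * (((∫ x in P.Ω, energyDensity u u x) + ∫ x in P.Ω, energyGap u₁ u x) / 2) := by
    rw [← integral_neg, ← integral_add huu hgap, ← integral_div, ← integral_const_mul]
    refine integral_mono_ae (integrable_Efac_sub_mul hφ hφ₁ he).neg
      (((huu.add hgap).div_const 2).const_mul δ) ?_
    filter_upwards [hE] with x hx
    -- Young's inequality with weight 1 leaves half of the energy gap on the right, to be absorbed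
    -- later once `δ` is small.
    have h4 := abs_energyDensity_sub_le u₁ u x one_pos
    rw [one_mul, div_one] at h4
    refine (neg_le_abs _).trans ?_
    rw [abs_mul]
    exact mul_le_mul hx h4 (abs_nonneg _) ((abs_nonneg _).trans hx)
  rw [integral_Efac_energyGap hφ hφ₁ hu hu₁] at h1
  linarith

variable {ι : Type*} {l : Filter ι} {φs : ι → H1 P.Ω} {us : ι → Displacement P}

/-- Strong convergence of the strains follows from the stability estimate. Assuming `hL` replaces a
bound on the displacement by its strain. -/
theorem tendsto_integral_energyGap (hφ : InUnitInterval P φ)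
    (hφs : ∀ᶠ n in l, InUnitInterval P (φs n)) (hu : IsState P φ u)
    (hus : ∀ᶠ n in l, IsState P (φs n) (us n))
    (hE : TendstoUniformlyAE (volume.restrict P.Ω) (fun n x => P.Efac ((φs n).val x))
      (fun x => P.Efac (φ.val x)) l)
    (hf : TendstoUniformlyAE (volume.restrict P.Ω) (fun n x => P.ffac ((φs n).val x))
      (fun x => P.ffac (φ.val x)) l)
    (hL : Tendsto (fun n => ∫ x in P.Ω, |(us n).f0dot x - u.f0dot x|) l (𝓝 0)) :
    Tendsto (fun n => ∫ x in P.Ω, energyGap (us n) u x) l (𝓝 0) := by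
  rw [Metric.tendsto_nhds]
  intro ε hε
  have hm := P.Emin_mem.1
  set Q := ∫ x in P.Ω, energyDensity u u x
  have hQ : 0 ≤ Q := integral_nonneg fun x => energyDensity_self_nonneg u x
  -- With `G` the integrated gap, the estimate reads `Emin * G ≤ δ * 1 + δ * (Q + G) / 2`. The first
  -- bound on `δ` absorbs `G`, the second makes the rest at most `Emin * ε / 4`.
  set δ := min P.Emin (P.Emin * ε / (2 * (Q + 2))) with hδ
  have hδ0 : 0 < δ := by positivity
  filter_upwards [hφs, hus, hE δ hδ0, hf δ hδ0, hL.eventually_lt_const one_pos] with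
    n h1 h2 h3 h4 h5
  have key := integral_energyGap_le hφ h1 hu h2 h3 h4
  have hG : 0 ≤ ∫ x in P.Ω, energyGap (us n) u x :=
    integral_nonneg fun x => energyGap_nonneg _ _ x
  rw [Real.dist_eq, sub_zero, abs_of_nonneg hG]
  set G := ∫ x in P.Ω, energyGap (us n) u x
  have k1 : δ * G ≤ P.Emin * G := mul_le_mul_of_nonneg_right (min_le_left _ _) hG
  have k2 : δ * (Q + 2) ≤ P.Emin * ε / 2 := by
    calc _ ≤ P.Emin * ε / (2 * (Q + 2)) * (Q + 2) := by gcongr; exact min_le_right _ _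
      _ = _ := by field_simp
  have k3 := mul_lt_mul_of_pos_left h5 hδ0
  have k4 : 0 < P.Emin * ε := by positivity
  have : P.Emin * G < P.Emin * ε := by
    nlinarith
  exact lt_of_mul_lt_mul_left this hm.le

theorem tendsto_integral_abs_energyDensity_sub
    (h : Tendsto (fun n => ∫ x in P.Ω, energyGap (us n) u x) l (𝓝 0)) :
    Tendsto (fun n => ∫ x in P.Ω, |energyDensity (us n) u x - energyDensity u u x|) l
      (𝓝 0) := by
  rw [Metric.tendsto_nhds]
  intro ε hε
  set Q := ∫ x in P.Ω, energyDensity u u x with hQe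
  have hQ : 0 ≤ Q := integral_nonneg fun x => energyDensity_self_nonneg u x
  -- The Young weight is fixed first so that `δ * Q ≤ ε`; the gap is then taken below `δ * ε`.
  set δ := ε / (Q + 1) with hδ
  have hδ0 : 0 < δ := by positivity
  filter_upwards [h.eventually_lt_const (show 0 < δ * ε by positivity)] with n hn
  have huu := integrable_energyDensity u u
  have hgap := integrable_energyGap (us n) u
  have hle : ∫ x in P.Ω, |energyDensity (us n) u x - energyDensity u u x| ≤
      (δ * Q + (∫ x in P.Ω, energyGap (us n) u x) / δ) / 2 := by
    rw [hQe, ← integral_const_mul, ← integral_div,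
      ← integral_add (huu.const_mul δ) (hgap.div_const δ), ← integral_div]
    exact integral_mono ((integrable_energyDensity (us n) u).sub huu).abs
      (((huu.const_mul δ).add (hgap.div_const δ)).div_const 2)
      fun x => abs_energyDensity_sub_le (us n) u x hδ0
  rw [Real.dist_eq, sub_zero, abs_of_nonneg (integral_nonneg fun x => abs_nonneg _)]
  have k1 : δ * Q ≤ ε := by
    calc _ ≤ δ * (Q + 1) := by gcongr; linarith
      _ = ε := by rw [hδ]; field_simp
  have k2 : (∫ x in P.Ω, energyGap (us n) u x) / δ < ε := by
    rw [div_lt_iff₀ hδ0]; linarith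
  linarith

end Elasticity

/-! ### Derivatives along curves of phase fields -/

section Curves

variable {d : ℕ} {P : Data d}

theorem Data.isFiniteMeasure_restrict (P : Data d) : IsFiniteMeasure (volume.restrict P.Ω) :=
  ⟨by simpa using P.bounded.measure_lt_top⟩

variable {φ : ℝ → H1 P.Ω} {φ' : H1 P.Ω} {t : ℝ}

theorem HasTimeDeriv.tendstoUniformlyAE (h : HasTimeDeriv φ φ' t) :
    TendstoUniformlyAE (volume.restrict P.Ω)
      (fun h x => h⁻¹ * ((φ (t + h)).val x - (φ t).val x)) φ'.val (𝓝[≠] 0) :=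
  tendstoUniformlyAE_of_eLpNorm_top h.2.2

theorem eventually_nhdsNE_zero_of_nhds {p : ℝ → Prop} (h : ∀ᶠ τ in 𝓝 t, p τ) :
    ∀ᶠ s in 𝓝[≠] (0 : ℝ), p (t + s) := by
  have : Tendsto (fun s : ℝ => t + s) (𝓝[≠] 0) (𝓝 t) := by
    have hc : Continuous fun s : ℝ => t + s := by fun_prop
    simpa using (hc.tendsto 0).mono_left nhdsWithin_le_nhds
  exact this.eventually h

/-- The time derivative of a curve with values in `[0, 1]` is essentially bounded. -/
theorem HasTimeDeriv.exists_bound (h : HasTimeDeriv φ φ' t)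
    (hφ : ∀ᶠ τ in 𝓝 t, InUnitInterval P (φ τ)) :
    ∃ M, ∀ᵐ x ∂(volume.restrict P.Ω), |φ'.val x| ≤ M := by
  -- A single difference quotient within 1 of `φ'` suffices: it is bounded by `|s⁻¹|`, as both
  -- values lie in `[0,1]`.
  obtain ⟨s, h1, h2⟩ := ((eventually_nhdsNE_zero_of_nhds hφ).and
    (h.tendstoUniformlyAE 1 one_pos)).exists
  refine ⟨1 + |s⁻¹|, ?_⟩
  filter_upwards [h1, hφ.self_of_nhds, h2] with x hx1 hx2 hx3
  have h4 : |s⁻¹ * ((φ (t + s)).val x - (φ t).val x)| ≤ |s⁻¹| := by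
    rw [abs_mul]
    refine mul_le_of_le_one_right (abs_nonneg _) (abs_le.2 ⟨?_, ?_⟩) <;>
      linarith [hx1.1, hx1.2, hx2.1, hx2.2]
  rw [abs_le] at hx3 h4 ⊢
  constructor <;> linarith

theorem HasTimeDeriv.slope_comp (h : HasTimeDeriv φ φ' t)
    (hφ : ∀ᶠ τ in 𝓝 t, InUnitInterval P (φ τ)) {θ : ℝ → ℝ} (hθ : Differentiable ℝ θ)
    (hθ' : Continuous (deriv θ)) :
    TendstoUniformlyAE (volume.restrict P.Ω)
      (fun h x => h⁻¹ * (θ ((φ (t + h)).val x) - θ ((φ t).val x)))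
      (fun x => deriv θ ((φ t).val x) * φ'.val x) (𝓝[≠] 0) := by
  obtain ⟨M, hM⟩ := h.exists_bound hφ
  exact h.tendstoUniformlyAE.slope_comp (f := fun s => (φ (t + s)).val)
    (fun r => (hθ r).hasDerivAt) hθ' hM
    hφ.self_of_nhds (eventually_nhdsNE_zero_of_nhds hφ)

theorem HasTimeDeriv.exists_bound_comp (h : HasTimeDeriv φ φ' t)
    (hφ : ∀ᶠ τ in 𝓝 t, InUnitInterval P (φ τ)) {θ' : ℝ → ℝ} (hθ' : Continuous θ') :
    ∃ M, ∀ᵐ x ∂(volume.restrict P.Ω), |θ' ((φ t).val x) * φ'.val x| ≤ M := by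
  obtain ⟨M, hM⟩ := h.exists_bound hφ
  obtain ⟨K, hK⟩ := (isCompact_Icc (a := (0 : ℝ)) (b := 1)).exists_bound_of_continuousOn
    hθ'.continuousOn
  refine ⟨K * M, ?_⟩
  filter_upwards [hM, hφ.self_of_nhds] with x h1 h2
  rw [abs_mul]
  have h3 : |θ' ((φ t).val x)| ≤ K := hK _ h2
  exact mul_le_mul h3 h1 (abs_nonneg _) ((abs_nonneg _).trans h3)

theorem aestronglyMeasurable_deriv_comp {θ' : ℝ → ℝ} (hθ' : Continuous θ') (φ φ' : H1 P.Ω) :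
    AEStronglyMeasurable (fun x => θ' (φ.val x) * φ'.val x) (volume.restrict P.Ω) :=
  (Data.aestronglyMeasurable_comp hθ' φ).mul φ'.memLp_val.1

theorem HasTimeDeriv.integrable_mul (h : HasTimeDeriv φ φ' t)
    (hφ : ∀ᶠ τ in 𝓝 t, InUnitInterval P (φ τ)) {θ' : ℝ → ℝ} (hθ' : Continuous θ')
    {g : Pt d → ℝ} (hg : Integrable g (volume.restrict P.Ω)) :
    Integrable (fun x => θ' ((φ t).val x) * φ'.val x * g x) (volume.restrict P.Ω) := by
  obtain ⟨M, hM⟩ := h.exists_bound_comp hφ hθ'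
  exact hg.bdd_mul (aestronglyMeasurable_deriv_comp hθ' _ _) hM

/-- Limit of difference quotients of a superposition, paired with an `L¹`-convergent family. -/
theorem HasTimeDeriv.tendsto_integral_slope_mul (h : HasTimeDeriv φ φ' t)
    (hφ : ∀ᶠ τ in 𝓝 t, InUnitInterval P (φ τ)) {θ : ℝ → ℝ} (hθ : Differentiable ℝ θ)
    (hθ' : Continuous (deriv θ)) {G : ℝ → Pt d → ℝ} {G₀ : Pt d → ℝ}
    (hG : ∀ s, Integrable (G s) (volume.restrict P.Ω))
    (hG₀ : Integrable G₀ (volume.restrict P.Ω))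
    (hlim : Tendsto (fun s => ∫ x in P.Ω, |G s x - G₀ x|) (𝓝[≠] 0) (𝓝 0)) :
    Tendsto (fun s : ℝ => s⁻¹ * ∫ x in P.Ω, (θ ((φ (t + s)).val x) - θ ((φ t).val x)) * G s x)
      (𝓝[≠] 0) (𝓝 (∫ x in P.Ω, deriv θ ((φ t).val x) * φ'.val x * G₀ x)) := by
  obtain ⟨M, hM⟩ := h.exists_bound_comp hφ hθ'
  refine ((h.slope_comp hφ hθ hθ').tendsto_integral_mul (fun s => ?_)
    (aestronglyMeasurable_deriv_comp hθ' _ _) hM hG hG₀ hlim).congr fun s => ?_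
  · exact ((Data.aestronglyMeasurable_comp hθ.continuous _).sub
      (Data.aestronglyMeasurable_comp hθ.continuous _)).const_mul _
  · rw [← integral_const_mul]
    simp only [mul_assoc]

theorem InUnitInterval.integrable_comp {ψ : H1 P.Ω} (hψ : InUnitInterval P ψ) {θ : ℝ → ℝ}
    (hθ : Continuous θ) : Integrable (fun x => θ (ψ.val x)) (volume.restrict P.Ω) := by
  have := P.isFiniteMeasure_restrict
  simpa using hψ.integrable_mul hθ (integrable_const (1 : ℝ))

theorem HasTimeDeriv.hasDerivAt_integral_comp (h : HasTimeDeriv φ φ' t)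
    (hφ : ∀ᶠ τ in 𝓝 t, InUnitInterval P (φ τ)) {θ : ℝ → ℝ} (hθ : Differentiable ℝ θ)
    (hθ' : Continuous (deriv θ)) :
    HasDerivAt (fun τ => ∫ x in P.Ω, θ ((φ τ).val x))
      (∫ x in P.Ω, deriv θ ((φ t).val x) * φ'.val x) t := by
  have := P.isFiniteMeasure_restrict
  rw [hasDerivAt_iff_tendsto_slope_zero]
  have key := h.tendsto_integral_slope_mul hφ hθ hθ' (G := fun _ _ => 1) (G₀ := fun _ => 1)
    (fun _ => integrable_const 1) (integrable_const 1) (by simp)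
  simp only [mul_one] at key
  refine key.congr' ?_
  filter_upwards [eventually_nhdsNE_zero_of_nhds hφ] with s hs
  rw [integral_sub (hs.integrable_comp hθ.continuous)
    (hφ.self_of_nhds.integrable_comp hθ.continuous), smul_eq_mul]

/-- Shape derivative of the compliance. -/
theorem HasTimeDeriv.hasDerivAt_load (h : HasTimeDeriv φ φ' t)
    (hφ : ∀ᶠ τ in 𝓝 t, InUnitInterval P (φ τ)) {u : ℝ → Displacement P}
    (hu : ∀ᶠ τ in 𝓝 t, IsState P (φ τ) (u τ))
    (hcont : ∀ i, Tendsto (fun τ => eLpNorm (fun x => ((u τ).comp i).val x -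
      ((u t).comp i).val x) 2 (volume.restrict P.Ω)) (𝓝 t) (𝓝 0)) :
    HasDerivAt (fun τ => load P (φ τ) (u τ))
      (2 * (∫ x in P.Ω, deriv P.ffac ((φ t).val x) * φ'.val x * (u t).f0dot x) -
        ∫ x in P.Ω, deriv P.Efac ((φ t).val x) * φ'.val x * energyDensity (u t) (u t) x) t := by
  have hφt := hφ.self_of_nhds
  have hut := hu.self_of_nhds
  have hφs := eventually_nhdsNE_zero_of_nhds hφ
  have hus := eventually_nhdsNE_zero_of_nhds hu
  have hshift : Tendsto (fun s : ℝ => t + s) (𝓝[≠] 0) (𝓝 t) := by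
    have hc : Continuous fun s : ℝ => t + s := by fun_prop
    simpa using (hc.tendsto 0).mono_left nhdsWithin_le_nhds
  have hL : Tendsto (fun s => ∫ x in P.Ω, |(u (t + s)).f0dot x - (u t).f0dot x|)
      (𝓝[≠] 0) (𝓝 0) :=
    tendsto_integral_abs_f0dot_sub fun i => (hcont i).comp hshift
  have dE := P.differentiable_Efac
  have df := P.differentiable_ffac
  have cE := P.continuous_deriv_Efac
  have cf := P.continuous_deriv_ffac
  obtain ⟨ME, hME⟩ := h.exists_bound_comp hφ cE
  obtain ⟨Mf, hMf⟩ := h.exists_bound_comp hφ cf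
  have hgap := tendsto_integral_energyGap hφt hφs hut hus
    (.of_slope hME (f := fun s x => P.Efac ((φ (t + s)).val x)) (h.slope_comp hφ dE cE))
    (.of_slope hMf (f := fun s x => P.ffac ((φ (t + s)).val x)) (h.slope_comp hφ df cf)) hL
  rw [hasDerivAt_iff_tendsto_slope_zero]
  have k1 := h.tendsto_integral_slope_mul hφ df cf (fun s => (u (t + s)).integrable_f0dot)
    (u t).integrable_f0dot hL
  have k2 := h.tendsto_integral_slope_mul hφ df cf (G := fun _ => (u t).f0dot)
    (fun _ => (u t).integrable_f0dot) (u t).integrable_f0dot (by simp)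
  have k3 := h.tendsto_integral_slope_mul hφ dE cE
    (fun s => integrable_energyDensity (u (t + s)) (u t))
    (integrable_energyDensity (u t) (u t)) (tendsto_integral_abs_energyDensity_sub hgap)
  -- The terms with `u (t + s)` and with `u t` have the same limit, whence the factor 2 on the force
  -- term.
  have key := (k1.add k2).sub k3
  rw [← two_mul] at key
  refine key.congr' ?_
  filter_upwards [hφs, hus] with s h1 h2
  rw [compliance_sub hφt h1 hut h2, smul_eq_mul]
  ring

/-- Derivative of the objective along a curve of phase fields and states. -/
theorem HasTimeDeriv.hasDerivAt_J (h : HasTimeDeriv φ φ' t)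
    (hφ : ∀ᶠ τ in 𝓝 t, InUnitInterval P (φ τ)) {u : ℝ → Displacement P}
    (hu : ∀ᶠ τ in 𝓝 t, IsState P (φ τ) (u τ))
    (hcont : ∀ i, Tendsto (fun τ => eLpNorm (fun x => ((u τ).comp i).val x -
      ((u t).comp i).val x) 2 (volume.restrict P.Ω)) (𝓝 t) (𝓝 0)) :
    HasDerivAt (fun τ => J P (φ τ) (u τ))
      (2 * (∫ x in P.Ω, deriv P.ffac ((φ t).val x) * φ'.val x * (u t).f0dot x) -
        (∫ x in P.Ω, deriv P.Efac ((φ t).val x) * φ'.val x * energyDensity (u t) (u t) x) +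
        (P.γ * P.ε * (∫ x in P.Ω, inner ℝ ((φ t).grad x) (φ'.grad x)) +
          P.γ / P.ε * ∫ x in P.Ω, deriv well ((φ t).val x) * φ'.val x)) t := by
  have k1 := h.hasDerivAt_load hφ hu hcont
  have k2 := hasDerivAt_integral_norm_sq (g := fun τ => (φ τ).grad)
    (fun τ => (φ τ).memLp_grad) φ'.memLp_grad h.2.1
  have k3 := h.hasDerivAt_integral_comp hφ differentiable_well continuous_deriv_well
  have key := k1.add (((k2.const_mul (P.ε / 2)).add (k3.const_mul (1 / P.ε))).const_mul P.γ)
  refine (key.congr_of_eventuallyEq ?_).congr_deriv ?_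
  · filter_upwards [hφ] with τ hτ
    have i1 : Integrable (fun x => P.ε / 2 * ‖(φ τ).grad x‖ ^ 2) (volume.restrict P.Ω) :=
      ((φ τ).memLp_grad.integrable_norm_pow two_ne_zero).const_mul _
    have i2 : Integrable (fun x => 1 / P.ε * well ((φ τ).val x)) (volume.restrict P.Ω) :=
      (hτ.integrable_comp differentiable_well.continuous).const_mul _
    simp only [J, Pi.add_apply]
    rw [integral_add i1 i2, integral_const_mul, integral_const_mul]
  · ring

end Curves

/-! ### Vanishing work of the multipliers and energy dissipation -/

section GradientFlow

variable {d : ℕ} {P : Data d} {φ₀ : Pt d → ℝ} {φ φt : ℝ → H1 P.Ω} {u : ℝ → Displacement P}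
  {lam : ℝ → ℝ} {η : ℝ → Pt d → ℝ} {t : ℝ}

theorem IsSolution.inUnitInterval (hsol : IsSolution P φ₀ φ φt u lam η) (ht : 0 < t) :
    InUnitInterval P (φ t) := by
  filter_upwards [hsol.bound_constraint t ht] with x hx
  constructor <;> nlinarith [hx.2.1]

theorem IsSolution.eventually_inUnitInterval (hsol : IsSolution P φ₀ φ φt u lam η)
    (ht : 0 < t) : ∀ᶠ τ in 𝓝 t, InUnitInterval P (φ τ) :=
  (lt_mem_nhds ht).mono fun _ => hsol.inUnitInterval

/-- Conservation of volume. -/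
theorem IsSolution.integral_timeDeriv_eq_zero (hsol : IsSolution P φ₀ φ φt u lam η)
    (ht : 0 < t) : ∫ x in P.Ω, (φt t).val x = 0 := by
  have h1 := (hsol.timeDeriv t ht).hasDerivAt_integral_comp
    (hsol.eventually_inUnitInterval ht) differentiable_id (by simpa using continuous_const)
  have h2 : HasDerivAt (fun τ => ∫ x in P.Ω, id ((φ τ).val x)) 0 t := by
    refine (hasDerivAt_const t P.V0).congr_of_eventuallyEq ?_
    filter_upwards [lt_mem_nhds ht] with τ hτ
    exact sub_eq_zero.1 (hsol.volume_constraint τ hτ).2.1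
  simpa using h1.unique h2

/-- The multiplier of the bound constraint does no work. -/
theorem IsSolution.eta_mul_timeDeriv (hsol : IsSolution P φ₀ φ φt u lam η) (ht : 0 < t) :
    ∀ᵐ x ∂(volume.restrict P.Ω), η t x * (φt t).val x = 0 := by
  filter_upwards [hsol.bound_constraint t ht,
    TendstoUniformlyAE.eq_zero_of_mem_bounds (f := fun s => (φ (t + s)).val)
      (eventually_nhdsNE_zero_of_nhds (hsol.eventually_inUnitInterval ht))
      (hsol.timeDeriv t ht).tendstoUniformlyAE] with x h1 h2
  rcases mul_eq_zero.1 h1.2.2 with h3 | h3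
  · rw [h3, zero_mul]
  · rw [h2 h3, mul_zero]

/-- The gradient flow, tested with the time derivative. -/
theorem IsSolution.integral_sq_timeDeriv (hsol : IsSolution P φ₀ φ φt u lam η) (ht : 0 < t) :
    ∫ x in P.Ω, (φt t).val x ^ 2 =
      -(P.γ * P.ε * ∫ x in P.Ω, inner ℝ ((φ t).grad x) ((φt t).grad x)) +
      (-(P.γ / P.ε) * (∫ x in P.Ω, deriv well ((φ t).val x) * (φt t).val x) +
        (∫ x in P.Ω, deriv P.Efac ((φ t).val x) * (φt t).val x *
          energyDensity (u t) (u t) x) -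
        2 * ∫ x in P.Ω, deriv P.ffac ((φ t).val x) * (φt t).val x * (u t).f0dot x) := by
  have hφ := hsol.eventually_inUnitInterval ht
  have hd := hsol.timeDeriv t ht
  have := P.isFiniteMeasure_restrict
  obtain ⟨M, hM⟩ := hd.exists_bound hφ
  -- Essential boundedness makes `φt t` an admissible test function.
  have hflow := hsol.flow t ht (φt t) (memLp_top_of_bound (φt t).memLp_val.1 M hM)
  have i1 : Integrable (fun x => -(P.γ / P.ε) * (deriv well ((φ t).val x) * (φt t).val x))
      (volume.restrict P.Ω) := by
    simpa using (hd.integrable_mul hφ continuous_deriv_well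
      (integrable_const (1 : ℝ))).const_mul (-(P.γ / P.ε))
  have i2 := hd.integrable_mul hφ P.continuous_deriv_Efac (integrable_energyDensity (u t) (u t))
  have i3 := (hd.integrable_mul hφ P.continuous_deriv_ffac (u t).integrable_f0dot).const_mul 2
  have i4 : Integrable (fun x => lam t * (φt t).val x) (volume.restrict P.Ω) :=
    ((φt t).memLp_val.integrable one_le_two).const_mul _
  have i12 : Integrable (fun x => -(P.γ / P.ε) * (deriv well ((φ t).val x) * (φt t).val x) +
      deriv P.Efac ((φ t).val x) * (φt t).val x * energyDensity (u t) (u t) x)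
      (volume.restrict P.Ω) := i1.add i2
  have hlam : ∫ x in P.Ω, lam t * (φt t).val x = 0 := by
    rw [integral_const_mul, hsol.integral_timeDeriv_eq_zero ht, mul_zero]
  have i123 : Integrable (fun x => -(P.γ / P.ε) * (deriv well ((φ t).val x) * (φt t).val x) +
      deriv P.Efac ((φ t).val x) * (φt t).val x * energyDensity (u t) (u t) x -
      2 * (deriv P.ffac ((φ t).val x) * (φt t).val x * (u t).f0dot x))
      (volume.restrict P.Ω) := i12.sub i3
  simp only [sq]
  rw [hflow]
  congr 1
  rw [← integral_const_mul (-(P.γ / P.ε)), ← integral_const_mul 2, ← integral_add i1 i2,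
    ← integral_sub i12 i3]
  refine Eq.trans ?_ ((integral_sub i123 i4).trans (by rw [hlam, sub_zero]))
  refine integral_congr_ae ?_
  filter_upwards [hsol.eta_mul_timeDeriv ht] with x hx
  simp only [energyDensity]
  -- The two integrands differ only by `η (1 - 2φ) φ_t`, which vanishes almost everywhere.
  linear_combination (-(1 - 2 * (φ t).val x)) * hx

end GradientFlow

end PhaseFieldTopOpt

theorem theorem2 {d : ℕ} (hd : 2 ≤ d) (P : PhaseFieldTopOpt.Data d)
    (φ₀ : PhaseFieldTopOpt.Pt d → ℝ) (φ φt : ℝ → PhaseFieldTopOpt.H1 P.Ω)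
    (u : ℝ → PhaseFieldTopOpt.Displacement P) (lam : ℝ → ℝ)
    (η : ℝ → PhaseFieldTopOpt.Pt d → ℝ)
    (hsol : PhaseFieldTopOpt.IsSolution P φ₀ φ φt u lam η) (t : ℝ) (ht : 0 < t) :
    HasDerivAt (fun τ => PhaseFieldTopOpt.J P (φ τ) (u τ))
        (-(∫ x in P.Ω, ((φt t).val x) ^ 2)) t ∧
      -(∫ x in P.Ω, ((φt t).val x) ^ 2) ≤ 0 := by
  refine ⟨?_, neg_nonpos.2 (integral_nonneg fun x => sq_nonneg _)⟩
  refine ((hsol.timeDeriv t ht).hasDerivAt_J (hsol.eventually_inUnitInterval ht)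
    ((lt_mem_nhds ht).mono hsol.state) (hsol.continuous_u t ht)).congr_deriv ?_
  rw [hsol.integral_sq_timeDeriv ht]
  ring
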